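/- Let $M$ be a smooth ($C^\infty$), connected, paracompact, Hausdorff finite-dimensional manifold without boundary, with tangent bundle $\pi : TM \to M$, and let $\mathcal V = \ker(\pi_* : TTM \to TM)$ be the vertical bundle over $TM$. A \emph{quasispray} on $M$ is a smooth vector field $S$ on $TM$ which is a second-order differential equation, i.e. $\pi_*(S(v)) = v$ for all $v \in TM$, and which vanishes on the zero section of $TM$. An (Ehresmann, possibly nonlinear) \emph{connection} on $M$ is a smooth vector subbundle $\mathcal H$ of $TTM \to TM$ such that $T_vTM = \mathcal H_v \oplus \mathcal V_v$ for every $v \in TM$. The \emph{geodesic quasispray} of $\mathcal H$ is the vector field $v \mapsto (\pi_*|_{\mathcal H_v})^{-1}(v)$ on $TM$, and $\mathcal H$ is \emph{compatible} with $S$ if its geodesic quasispray is $S$. Theorem (extended Ambrose--Palais--Singer). For every quasispray $S$ on $M$ there exists a connection $\mathcal H$ on $M$ compatible with $S$. -/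

import Mathlib

open Set Bundle Manifold Topology
open scoped ContDiff

noncomputable section

section Subbundle

/-- A family `D` of subspaces of the tangent spaces of a manifold `N` is a smooth vector subbundle
of `TN`: near every point it is spanned by a frame of linearly independent smooth vector fields. -/
def IsSmoothSubbundle {F : Type*} [NormedAddCommGroup F] [NormedSpace ℝ F]
    {K : Type*} [TopologicalSpace K] (J : ModelWithCorners ℝ F K)
    {N : Type*} [TopologicalSpace N] [ChartedSpace K N] [IsManifold J ∞ N]
    (D : ∀ x : N, Submodule ℝ (TangentSpace J x)) : Prop :=
  ∀ x₀ : N, ∃ k : ℕ, ∃ U ∈ 𝓝 x₀, ∃ X : Fin k → ∀ x : N, TangentSpace J x,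
    (∀ i, ContMDiffOn J J.tangent ∞ (fun x => (⟨x, X i x⟩ : TangentBundle J N)) U) ∧
    ∀ x ∈ U, LinearIndependent ℝ (fun i => X i x) ∧
      Submodule.span ℝ (Set.range fun i => X i x) = D x

end Subbundle

variable {E : Type*} [NormedAddCommGroup E] [NormedSpace ℝ E]
  {M : Type*} [TopologicalSpace M] [ChartedSpace E M] [IsManifold 𝓘(ℝ, E) ∞ M]

/-- The differential `π_* : T_v TM → T_{π v} M` of the projection `π : TM → M`. -/
def projDiff (v : TangentBundle 𝓘(ℝ, E) M) :
    TangentSpace 𝓘(ℝ, E).tangent v →L[ℝ] TangentSpace 𝓘(ℝ, E) v.proj :=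
  mfderiv 𝓘(ℝ, E).tangent 𝓘(ℝ, E) (fun w : TangentBundle 𝓘(ℝ, E) M => w.proj) v

/-- The vertical space `V_v = ker (π_* : T_v TM → T_{π v} M)`. -/
def verticalSpace (v : TangentBundle 𝓘(ℝ, E) M) :
    Submodule ℝ (TangentSpace 𝓘(ℝ, E).tangent v) :=
  LinearMap.ker (projDiff v).toLinearMap

/-- In the induced coordinates `π_*` is `(X, Y) ↦ X`. -/
theorem projDiff_apply (v : TangentBundle 𝓘(ℝ, E) M)
    (z : TangentSpace 𝓘(ℝ, E).tangent v) : projDiff v z = (show E × E from z).1 := by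
  have h : HasMFDerivAt 𝓘(ℝ, E).tangent 𝓘(ℝ, E) (fun w : TangentBundle 𝓘(ℝ, E) M => w.proj) v
      (ContinuousLinearMap.fst ℝ E E) := by
    refine ⟨(FiberBundle.continuous_proj E (TangentSpace 𝓘(ℝ, E) (M := M))).continuousAt, ?_⟩
    have key : ∀ y ∈ (extChartAt 𝓘(ℝ, E).tangent v).target,
        writtenInExtChartAt 𝓘(ℝ, E).tangent 𝓘(ℝ, E) v
          (fun w : TangentBundle 𝓘(ℝ, E) M => w.proj) y = y.1 := by
      intro y hy
      have hy' : y.1 ∈ (chartAt E v.proj).target := by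
        simp only [extChartAt, OpenPartialHomeomorph.extend, mfld_simps] at hy
        exact (TangentBundle.mem_chart_target_iff _ v).1 hy
      simp only [writtenInExtChartAt, mfld_simps, TangentBundle.coe_chartAt_symm_fst]
      exact (chartAt E v.proj).right_inv hy'
    refine HasFDerivWithinAt.congr_of_eventuallyEq hasFDerivAt_fst.hasFDerivWithinAt ?_
      (key _ (mem_extChartAt_target v))
    filter_upwards [extChartAt_target_mem_nhdsWithin (I := 𝓘(ℝ, E).tangent) v] with y hy
    exact key y hy
  have h2 := congrArg (fun L => L z) h.mfderiv
  exact h2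

theorem projDiff_surjective (v : TangentBundle 𝓘(ℝ, E) M) :
    Function.Surjective (projDiff v) := fun u =>
  ⟨(show E × E from (u, 0)), projDiff_apply v _⟩

/-- A quasispray on `M`: a smooth vector field `S` on `TM` (a section of `TTM → TM`) which is a
second-order differential equation, `π_* (S v) = v`, and which vanishes on the zero section. -/
structure IsQuasispray
    (S : ∀ v : TangentBundle 𝓘(ℝ, E) M, TangentSpace 𝓘(ℝ, E).tangent v) : Prop where
  smooth : ContMDiff 𝓘(ℝ, E).tangent 𝓘(ℝ, E).tangent.tangent ∞
    (fun v => (⟨v, S v⟩ : TangentBundle 𝓘(ℝ, E).tangent (TangentBundle 𝓘(ℝ, E) M)))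
  sode : ∀ v, projDiff v (S v) = v.snd
  zero : ∀ p : M, S ⟨p, 0⟩ = 0

variable (E M) in
/-- An (Ehresmann, possibly nonlinear) connection on `M`: a smooth subbundle of `TTM → TM`
complementary to the vertical bundle. -/
structure EhresmannConnection where
  hor : ∀ v : TangentBundle 𝓘(ℝ, E) M, Submodule ℝ (TangentSpace 𝓘(ℝ, E).tangent v)
  isCompl : ∀ v, IsCompl (hor v) (verticalSpace v)
  smooth : IsSmoothSubbundle 𝓘(ℝ, E).tangent hor

namespace EhresmannConnection

variable (H : EhresmannConnection E M)

theorem projDiff_restrict_bijective (v : TangentBundle 𝓘(ℝ, E) M) :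
    Function.Bijective ((projDiff v).toLinearMap.domRestrict (H.hor v)) := by
  constructor
  · intro a b hab
    have h : (a - b : H.hor v).1 ∈ H.hor v ⊓ verticalSpace v := by
      refine ⟨(a - b).2, ?_⟩
      have h1 : projDiff v a.1 = projDiff v b.1 := hab
      change projDiff v (a.1 - b.1) = 0
      rw [map_sub, h1, sub_self]
    rw [(H.isCompl v).inf_eq_bot, Submodule.mem_bot] at h
    exact sub_eq_zero.mp (Subtype.ext h)
  · intro u
    obtain ⟨z, rfl⟩ := projDiff_surjective v u
    have hz : z ∈ H.hor v ⊔ verticalSpace v := by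
      rw [(H.isCompl v).sup_eq_top]; exact Submodule.mem_top
    obtain ⟨a, ha, b, hb, rfl⟩ := Submodule.mem_sup.mp hz
    refine ⟨⟨a, ha⟩, ?_⟩
    have hb0 : projDiff v b = 0 := hb
    change projDiff v a = projDiff v (a + b)
    rw [map_add, hb0, add_zero]

/-- The isomorphism `π_*|_{H_v} : H_v ≃ T_{π v} M`. -/
def projEquiv (v : TangentBundle 𝓘(ℝ, E) M) : H.hor v ≃ₗ[ℝ] TangentSpace 𝓘(ℝ, E) v.proj :=
  LinearEquiv.ofBijective _ (H.projDiff_restrict_bijective v)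

/-- The geodesic quasispray of a connection, `S(v) = (π_*|_{H_v})⁻¹ (v)`. -/
def geodesicQuasispray (v : TangentBundle 𝓘(ℝ, E) M) : TangentSpace 𝓘(ℝ, E).tangent v :=
  ((H.projEquiv v).symm v.snd : H.hor v)

/-- `H` is compatible with `S`: the geodesic quasispray of `H` is `S`. -/
def IsCompatible
    (S : ∀ v : TangentBundle 𝓘(ℝ, E) M, TangentSpace 𝓘(ℝ, E).tangent v) : Prop :=
  ∀ v, H.geodesicQuasispray v = S v

end EhresmannConnection

end

/-! A connection is the image of a horizontal lift, a linear right inverse `Γ v` of `π_*` at each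
`v`, and it is compatible with `S` exactly when `Γ v v = S v`. Both conditions are affine in `Γ`, so
local lifts can be averaged with a partition of unity pulled back from `M`; this reduces the problem
to one chart.

In a chart `S (x, y) = (y, s (x, y))`, and a lift has the form `u ↦ (u, A (x, y) u)`, so what is
needed is a smooth operator-valued `A` with `A (x, y) y = s (x, y)`. Since `S` vanishes on the zero
section, `s (x, 0) = 0`, and Hadamard's formula `A (x, y) = ∫₀¹ ∂_y s (x, t y) dt` provides one,
smooth across `y = 0` as well. No homogeneity of `S` is required. -/

/-! ### Parameter integrals and Hadamard's lemma -/

open MeasureTheory in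
/-- The integral over `[0, 1]` of a smooth function depends smoothly on parameters. -/
theorem contDiffOn_intervalIntegral_of_contDiffOn {P F : Type*}
    [NormedAddCommGroup P] [NormedSpace ℝ P]
    [NormedAddCommGroup F] [NormedSpace ℝ F] {s : Set P} (hs : IsOpen s) {n : ℕ∞}
    {g : P → ℝ → F} (hg : ContDiffOn ℝ n (Function.uncurry g) (s ×ˢ univ)) :
    ContDiffOn ℝ n (fun p => ∫ t in (0 : ℝ)..1, g p t) s := by
  -- The integral is the convolution of the indicator of `(0, 1]` with `G p`, evaluated at `0`.
  -- Convolution at `0` reads `G p` at `-t`, hence the sign in `G`; the cutoff `χ` is `1` on `[-1,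
  -- 1]` and makes the support compact.
  let χ : ContDiffBump (0 : ℝ) := ⟨1, 2, one_pos, one_lt_two⟩
  let G : P → ℝ → F := fun p t => χ t • g p (-t)
  have hG : ContDiffOn ℝ n (Function.uncurry G) (s ×ˢ univ) := by
    have h1 : ContDiffOn ℝ n (fun q : P × ℝ => χ q.2) (s ×ˢ univ) :=
      (χ.contDiff.comp contDiff_snd).contDiffOn
    refine h1.smul (hg.comp (contDiff_fst.prodMk contDiff_snd.neg).contDiffOn ?_)
    exact fun q hq => ⟨hq.1, mem_univ _⟩
  have hf : LocallyIntegrable ((Ioc (0 : ℝ) 1).indicator fun _ => (1 : ℝ)) volume :=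
    ((integrable_indicator_iff measurableSet_Ioc).2 (by simp)).locallyIntegrable
  have key := contDiffOn_convolution_right_with_param (μ := volume)
    (ContinuousLinearMap.lsmul ℝ ℝ : ℝ →L[ℝ] F →L[ℝ] F) hs
    (isCompact_closedBall (0 : ℝ) 2) (g := G) (n := n)
    (fun p t _ ht => by
      have : χ t = 0 := by
        apply χ.zero_of_le_dist
        have := not_le.1 (fun h => ht (Metric.mem_closedBall.2 h))
        exact this.le
      simp [G, this]) hf hG
  have h2 : ContDiffOn ℝ n (fun p : P => ((p, 0) : P × ℝ)) s :=
    (contDiff_id.prodMk contDiff_const).contDiffOn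
  refine (key.comp h2 fun p hp => ⟨hp, mem_univ _⟩).congr fun p _ => ?_
  rw [intervalIntegral.integral_of_le zero_le_one, ← integral_indicator measurableSet_Ioc]
  refine integral_congr_ae (Filter.Eventually.of_forall fun t => ?_)
  by_cases ht : t ∈ Ioc (0 : ℝ) 1
  · have : χ (-t) = 1 := χ.one_of_mem_closedBall (by
      simp only [mem_closedBall_zero_iff, norm_neg, Real.norm_eq_abs]
      rw [abs_of_pos ht.1]; exact ht.2)
    simp [ht, G, this]
  · simp [ht]

/-- A parametric Hadamard lemma: a smooth map vanishing at `y = 0` is of the form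
`f (x, y) = A (x, y) y` with `A` smooth. -/
theorem exists_contDiffOn_clm_apply_eq {X Y F : Type*} [NormedAddCommGroup X] [NormedSpace ℝ X]
    [NormedAddCommGroup Y] [NormedSpace ℝ Y] [NormedAddCommGroup F] [NormedSpace ℝ F]
    [CompleteSpace F] {Ω : Set X} (hΩ : IsOpen Ω) {f : X × Y → F}
    (hf : ContDiffOn ℝ ∞ f (Ω ×ˢ univ)) (hf0 : ∀ x ∈ Ω, f (x, 0) = 0) :
    ∃ A : X × Y → Y →L[ℝ] F, ContDiffOn ℝ ∞ A (Ω ×ˢ univ) ∧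
      ∀ x ∈ Ω, ∀ y, A (x, y) y = f (x, y) := by
  have hO : IsOpen (Ω ×ˢ (univ : Set Y)) := hΩ.prod isOpen_univ
  let D : X × Y → Y →L[ℝ] F := fun p => (fderiv ℝ f p).comp (ContinuousLinearMap.inr ℝ X Y)
  have hD : ContDiffOn ℝ ∞ D (Ω ×ˢ univ) :=
    (hf.fderiv_of_isOpen hO (m := ∞) (by simp)).clm_comp contDiffOn_const
  have hg : ContDiffOn ℝ ∞ (Function.uncurry fun (p : X × Y) (t : ℝ) => D (p.1, t • p.2))
      ((Ω ×ˢ univ) ×ˢ univ) := by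
    refine hD.comp (t := Ω ×ˢ univ) (f := fun q : (X × Y) × ℝ => (q.1.1, q.2 • q.1.2)) ?_ ?_
    · exact ContDiff.contDiffOn (by fun_prop)
    · exact fun q hq => ⟨hq.1.1, mem_univ _⟩
  refine ⟨_, contDiffOn_intervalIntegral_of_contDiffOn hO (n := ⊤) hg, fun x hx y => ?_⟩
  have hcont : Continuous fun t : ℝ => D (x, t • y) := by
    rw [← continuousOn_univ]
    refine hD.continuousOn.comp (f := fun t : ℝ => (x, t • y)) (by fun_prop) ?_
    exact fun t _ => ⟨hx, mem_univ _⟩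
  rw [ContinuousLinearMap.intervalIntegral_apply (hcont.intervalIntegrable _ _)]
  -- The integrand applied to `y` is the derivative of `t ↦ f (x, t • y)`, so the integral is `f (x,
  -- y) - f (x, 0)`.
  have hderiv : ∀ t ∈ uIcc (0 : ℝ) 1,
      HasDerivAt (fun t : ℝ => f (x, t • y)) (D (x, t • y) y) t := by
    intro t _
    have h1 : HasFDerivAt f (fderiv ℝ f (x, t • y)) (x, t • y) :=
      ((hf.contDiffAt (hO.mem_nhds ⟨hx, mem_univ _⟩)).differentiableAt (by simp)).hasFDerivAt
    have h2 : HasDerivAt (fun t : ℝ => (x, t • y)) ((0 : X), y) t := by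
      refine (hasDerivAt_const t x).prodMk ?_
      simpa using (hasDerivAt_id t).smul_const y
    exact h1.comp_hasDerivAt t h2
  have := intervalIntegral.integral_eq_sub_of_hasDerivAt hderiv
    ((hcont.clm_apply continuous_const).intervalIntegrable _ _)
  simpa [hf0 x hx] using this

/-! ### Paracompactness and σ-compactness -/

/-- A connected, locally compact, paracompact space is σ-compact. -/
theorem sigmaCompactSpace_of_connectedSpace (M : Type*) [TopologicalSpace M]
    [WeaklyLocallyCompactSpace M] [R1Space M] [ParacompactSpace M] [ConnectedSpace M] :
    SigmaCompactSpace M := by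
  choose K hK hxK using fun x : M => exists_compact_mem_nhds x
  obtain ⟨V, hVo, hVc, hVf, hVs⟩ := precise_refinement (fun x => interior (K x))
    (fun x => isOpen_interior)
    (iUnion_eq_univ_iff.2 fun x => ⟨x, mem_interior_iff_mem_nhds.2 (hxK x)⟩)
  have hVK : ∀ i, IsCompact (closure (V i)) := fun i =>
    (hK i).closure_of_subset ((hVs i).trans interior_subset)
  -- By local finiteness a compact set meets only finitely many `V i`, each with compact closure.
  have step : ∀ C : {C : Set M // IsCompact C}, ∃ C' : {C : Set M // IsCompact C},
      ∀ i, (V i ∩ C.1).Nonempty → V i ⊆ C'.1 := by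
    intro C
    have hfin := hVf.finite_nonempty_inter_compact C.2
    refine ⟨⟨⋃ i ∈ {i | (V i ∩ C.1).Nonempty}, closure (V i),
      hfin.isCompact_biUnion fun i _ => hVK i⟩, fun i hi => ?_⟩
    exact subset_closure.trans (subset_biUnion_of_mem (u := fun i => closure (V i)) hi)
  choose next hnext using step
  obtain ⟨x₀⟩ : Nonempty M := inferInstance
  let C : ℕ → {C : Set M // IsCompact C} := fun n => next^[n] ⟨{x₀}, isCompact_singleton⟩
  have hC : ∀ n i, (V i ∩ (C n).1).Nonempty → V i ⊆ (C (n + 1)).1 := by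
    intro n i h
    have : C (n + 1) = next (C n) := Function.iterate_succ_apply' _ _ _
    rw [this]
    exact hnext _ i h
  have hmem : ∀ x, ∃ i, x ∈ V i := fun x => mem_iUnion.1 (hVc ▸ mem_univ x)
  -- Any `V i` that meets `C n` lies in `C (n + 1)`, which makes the union both open and closed.
  have hclopen : IsClopen (⋃ n, (C n).1) := by
    constructor
    · refine isClosed_of_closure_subset fun x hx => ?_
      obtain ⟨i, hi⟩ := hmem x
      obtain ⟨y, hyV, hyC⟩ := mem_closure_iff.1 hx _ (hVo i) hi
      obtain ⟨n, hn⟩ := mem_iUnion.1 hyC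
      exact mem_iUnion.2 ⟨n + 1, hC n i ⟨y, hyV, hn⟩ hi⟩
    · refine isOpen_iff_mem_nhds.2 fun x hx => ?_
      obtain ⟨n, hn⟩ := mem_iUnion.1 hx
      obtain ⟨i, hi⟩ := hmem x
      exact Filter.mem_of_superset ((hVo i).mem_nhds hi)
        ((hC n i ⟨x, hi, hn⟩).trans (subset_iUnion (fun n => (C n).1) _))
  refine SigmaCompactSpace_iff_exists_compact_covering.2 ⟨fun n => (C n).1, fun n => (C n).2, ?_⟩
  exact hclopen.eq_univ ⟨x₀, mem_iUnion.2 ⟨0, rfl⟩⟩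

/-! ### Horizontal lifts: local existence, gluing, and the resulting connection -/

section HorizontalLift

variable {E : Type*} [NormedAddCommGroup E] [NormedSpace ℝ E]
  {M : Type*} [TopologicalSpace M] [ChartedSpace E M] [IsManifold 𝓘(ℝ, E) ∞ M]

/-- Over `U`, `Γ` is a smooth horizontal lift `T_{π v} M → T_v TM` which lifts `v` to `S v`.
Smoothness means that smooth vector fields on `M` have smooth lifts. -/
structure IsHorizontalLiftOn
    (S : ∀ v : TangentBundle 𝓘(ℝ, E) M, TangentSpace 𝓘(ℝ, E).tangent v)
    (Γ : ∀ v : TangentBundle 𝓘(ℝ, E) M,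
      TangentSpace 𝓘(ℝ, E) v.proj →ₗ[ℝ] TangentSpace 𝓘(ℝ, E).tangent v)
    (U : Set M) : Prop where
  projDiff_apply : ∀ v, v.proj ∈ U → ∀ u, projDiff v (Γ v u) = u
  apply_snd : ∀ v, v.proj ∈ U → Γ v v.snd = S v
  contMDiffAt : ∀ (X : ∀ x : M, TangentSpace 𝓘(ℝ, E) x) (v : TangentBundle 𝓘(ℝ, E) M),
    v.proj ∈ U →
    ContMDiffAt 𝓘(ℝ, E) 𝓘(ℝ, E).tangent ∞
      (fun x => (⟨x, X x⟩ : TangentBundle 𝓘(ℝ, E) M)) v.proj →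
    ContMDiffAt 𝓘(ℝ, E).tangent 𝓘(ℝ, E).tangent.tangent ∞
      (fun w => (⟨w, Γ w (X w.proj)⟩ :
        TangentBundle 𝓘(ℝ, E).tangent (TangentBundle 𝓘(ℝ, E) M))) v

/-- In the trivializations induced by a chart of `M`, `π_*` is the first projection. -/
theorem fst_continuousLinearMapAt_trivializationAt (v₀ v : TangentBundle 𝓘(ℝ, E) M)
    (hv : v.proj ∈ (chartAt E v₀.proj).source) (z : TangentSpace 𝓘(ℝ, E).tangent v) :
    ((trivializationAt (E × E) (TangentSpace 𝓘(ℝ, E).tangent) v₀).continuousLinearMapAt ℝ v z).1 =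
      (trivializationAt E (TangentSpace 𝓘(ℝ, E)) v₀.proj).continuousLinearMapAt ℝ v.proj
        (projDiff v z) := by
  have : IsManifold 𝓘(ℝ, E) 1 M := .of_le (n := ∞) (by simp)
  have hv' : v ∈ (chartAt (ModelProd E E) v₀).source := by
    rwa [TangentBundle.mem_chart_source_iff]
  rw [TangentBundle.continuousLinearMapAt_trivializationAt hv,
    TangentBundle.continuousLinearMapAt_trivializationAt hv']
  have h1 : HasMFDerivAt 𝓘(ℝ, E).tangent 𝓘(ℝ, E × E)
      (extChartAt 𝓘(ℝ, E).tangent v₀) v _ :=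
    (mdifferentiableAt_extChartAt hv').hasMFDerivAt
  have h2 : HasMFDerivAt 𝓘(ℝ, E) 𝓘(ℝ, E) (extChartAt 𝓘(ℝ, E) v₀.proj) v.proj _ :=
    (mdifferentiableAt_extChartAt hv).hasMFDerivAt
  have h3 : HasMFDerivAt 𝓘(ℝ, E).tangent 𝓘(ℝ, E)
      (fun w : TangentBundle 𝓘(ℝ, E) M => w.proj) v (projDiff v) :=
    ((contMDiff_proj (TangentSpace 𝓘(ℝ, E) (M := M)) (n := 1)).mdifferentiable
      one_ne_zero v).hasMFDerivAt
  have h4 : HasMFDerivAt 𝓘(ℝ, E × E) 𝓘(ℝ, E) (Prod.fst : E × E → E)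
      (extChartAt 𝓘(ℝ, E).tangent v₀ v) (ContinuousLinearMap.fst ℝ E E) :=
    hasFDerivAt_fst.hasMFDerivAt
  -- Both sides differentiate the same map: the first coordinate of the chart of `TM` is the chart
  -- of `M` after `π`.
  have h := hasMFDerivAt_unique (h4.comp v h1) (h2.comp v h3)
  exact congrArg (fun L : E × E →L[ℝ] E => L z) h

theorem snd_extChartAt_tangent (v₀ v : TangentBundle 𝓘(ℝ, E) M)
    (hv : v.proj ∈ (chartAt E v₀.proj).source) :
    (extChartAt 𝓘(ℝ, E).tangent v₀ v).2 =
      (trivializationAt E (TangentSpace 𝓘(ℝ, E)) v₀.proj).continuousLinearMapAt ℝ v.proj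
        v.snd := by
  rw [Trivialization.continuousLinearMapAt_apply, Trivialization.linearMapAt_apply]
  exact (if_pos hv).symm

/-- Hadamard's lemma, applied to the vertical component of `S` in the chart, gives the connection
coefficients over the whole chart domain. -/
theorem IsQuasispray.exists_isHorizontalLiftOn [CompleteSpace E]
    {S : ∀ v : TangentBundle 𝓘(ℝ, E) M, TangentSpace 𝓘(ℝ, E).tangent v}
    (hS : IsQuasispray S) (x₀ : M) :
    ∃ Γ, IsHorizontalLiftOn S Γ (chartAt E x₀).source := by
  have : IsManifold 𝓘(ℝ, E) 1 M := .of_le (n := ∞) (by simp)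
  let v₀ : TangentBundle 𝓘(ℝ, E) M := ⟨x₀, 0⟩
  let e := trivializationAt E (TangentSpace 𝓘(ℝ, E)) x₀
  let e' := trivializationAt (E × E) (TangentSpace 𝓘(ℝ, E).tangent) v₀
  let Φ := extChartAt 𝓘(ℝ, E).tangent v₀
  have hbase : ∀ v : TangentBundle 𝓘(ℝ, E) M,
      v ∈ e'.baseSet ↔ v.proj ∈ (chartAt E x₀).source := fun v =>
    TangentBundle.mem_chart_source_iff v v₀
  let s : TangentBundle 𝓘(ℝ, E) M → E := fun v => (e'.continuousLinearMapAt ℝ v (S v)).2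
  have hs : ContMDiffOn 𝓘(ℝ, E).tangent 𝓘(ℝ, E) ∞ s e'.baseSet := by
    have h := (e'.contMDiffOn_section_baseSet_iff (n := ∞)).1 (hS.smooth.contMDiffOn)
    have h' : ContMDiffOn 𝓘(ℝ, E).tangent 𝓘(ℝ, E) ∞
        (fun v => (e' ⟨v, S v⟩).2.2) e'.baseSet :=
      contDiff_snd.contMDiff.comp_contMDiffOn h
    refine h'.congr fun v hv => ?_
    change (e'.linearMapAt ℝ v (S v)).2 = _
    rw [Trivialization.linearMapAt_apply, if_pos hv]
  have htarget : Φ.target = (chartAt E x₀).target ×ˢ univ := by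
    ext p
    simp only [Φ, extChartAt, OpenPartialHomeomorph.extend, mfld_simps]
    exact (TangentBundle.mem_chart_target_iff p v₀)
  have hsource : Φ.source = e'.baseSet := extChartAt_source _ _
  obtain ⟨A, hA, hAf⟩ := exists_contDiffOn_clm_apply_eq (chartAt E x₀).open_target
    (f := fun p : E × E => s (Φ.symm p)) (by
      rw [← contMDiffOn_iff_contDiffOn, ← htarget]
      refine hs.comp (contMDiffOn_extChartAt_symm (n := ∞) v₀) fun p hp => ?_
      rw [mem_preimage, ← hsource]
      exact Φ.map_target hp) (by
      intro x hx
      have hp : (x, (0 : E)) ∈ Φ.target := by rw [htarget]; exact ⟨hx, mem_univ _⟩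
      have hv := Φ.map_target hp
      rw [hsource, hbase] at hv
      -- The chart of `TM` is linear on fibres, so it matches `y = 0` with the zero section.
      have h0 : Φ.symm (x, 0) = ⟨(Φ.symm (x, 0)).proj, 0⟩ := by
        have h1 := snd_extChartAt_tangent v₀ _ hv
        have h2 : (Φ (Φ.symm (x, 0))).2 = 0 := by rw [Φ.right_inv hp]
        rw [show extChartAt 𝓘(ℝ, E).tangent v₀ = Φ from rfl, h2] at h1
        have h3 := e.symmL_continuousLinearMapAt (R := ℝ) hv (Φ.symm (x, 0)).snd
        rw [← h1, map_zero] at h3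
        exact congrArg (TotalSpace.mk _) h3.symm
      change (e'.continuousLinearMapAt ℝ _ (S (Φ.symm (x, 0)))).2 = 0
      rw [h0, hS.zero, map_zero]
      rfl)
  have hAΦ : ContMDiffOn 𝓘(ℝ, E).tangent 𝓘(ℝ, E →L[ℝ] E) ∞ (fun v => A (Φ v)) e'.baseSet := by
    rw [← htarget, ← contMDiffOn_iff_contDiffOn] at hA
    refine hA.comp (contMDiffOn_extChartAt (n := ∞) (x := v₀)) fun v hv => ?_
    rw [← hsource] at hv
    exact Φ.map_source hv
  -- In coordinates this is `u ↦ (u, A u)`.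
  refine ⟨fun v => (e'.symmL ℝ v).toLinearMap ∘ₗ
    (LinearMap.prod LinearMap.id (A (Φ v)).toLinearMap) ∘ₗ
      (e.continuousLinearMapAt ℝ v.proj).toLinearMap, ?_, ?_, ?_⟩
  · intro v hv u
    have h := fst_continuousLinearMapAt_trivializationAt v₀ v hv
      (e'.symmL ℝ v (e.continuousLinearMapAt ℝ v.proj u,
        A (Φ v) (e.continuousLinearMapAt ℝ v.proj u)))
    rw [e'.continuousLinearMapAt_symmL ((hbase v).2 hv)] at h
    have h' := congrArg (e.symmL ℝ v.proj) h
    rw [e.symmL_continuousLinearMapAt hv, e.symmL_continuousLinearMapAt hv] at h'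
    exact h'.symm
  · intro v hv
    have hv' : v ∈ Φ.source := by rw [hsource, hbase]; exact hv
    have h : (e.continuousLinearMapAt ℝ v.proj v.snd,
        A (Φ v) (e.continuousLinearMapAt ℝ v.proj v.snd)) =
        e'.continuousLinearMapAt ℝ v (S v) := by
      refine Prod.ext ?_ ?_
      · have := fst_continuousLinearMapAt_trivializationAt v₀ v hv (S v)
        rw [hS.sode] at this
        exact this.symm
      · have h1 := hAf (Φ v).1 (by
          have := Φ.map_source hv'
          rw [htarget] at this
          exact this.1) (Φ v).2
        have h2 : (Φ v).2 = e.continuousLinearMapAt ℝ v.proj v.snd :=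
          snd_extChartAt_tangent v₀ v hv
        rw [Prod.mk.eta, Φ.left_inv hv', h2] at h1
        exact h1
    have h' := congrArg (e'.symmL ℝ v) h
    rw [e'.symmL_continuousLinearMapAt ((hbase v).2 hv)] at h'
    exact h'
  · intro X v hv hX
    have hvb : v ∈ e'.baseSet := (hbase v).2 hv
    refine (e'.contMDiffAt_section_iff hvb).2 ?_
    have hX' : ContMDiffAt 𝓘(ℝ, E).tangent 𝓘(ℝ, E) ∞
        (fun w : TangentBundle 𝓘(ℝ, E) M => (e ⟨w.proj, X w.proj⟩).2) v :=
      ((e.contMDiffAt_section_iff hv).1 hX).comp v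
        (contMDiff_proj (TangentSpace 𝓘(ℝ, E) (M := M))).contMDiffAt
    have hAv := hAΦ.contMDiffAt (e'.open_baseSet.mem_nhds hvb)
    refine (hX'.prodMk_space (hAv.clm_apply hX')).congr_of_eventuallyEq ?_
    filter_upwards [e'.open_baseSet.mem_nhds hvb] with w hw
    have hw' := (hbase w).1 hw
    have h1 : e.continuousLinearMapAt ℝ w.proj (X w.proj) = (e ⟨w.proj, X w.proj⟩).2 := by
      change e.linearMapAt ℝ _ _ = _
      rw [Trivialization.linearMapAt_apply]
      exact if_pos hw'
    have h2 := e'.continuousLinearMapAt_symmL (R := ℝ) hw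
      (e.continuousLinearMapAt ℝ w.proj (X w.proj),
        A (Φ w) (e.continuousLinearMapAt ℝ w.proj (X w.proj)))
    change e'.linearMapAt ℝ _ _ = _ at h2
    rw [Trivialization.linearMapAt_apply, if_pos hw, h1] at h2
    rw [← h2, ← h1]
    rfl

/-- Horizontal lifts can be glued by a partition of unity on the base. -/
theorem IsHorizontalLiftOn.finsum [FiniteDimensional ℝ E] {ι : Type*}
    {S : ∀ v : TangentBundle 𝓘(ℝ, E) M, TangentSpace 𝓘(ℝ, E).tangent v}
    {Γ : ι → ∀ v : TangentBundle 𝓘(ℝ, E) M,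
      TangentSpace 𝓘(ℝ, E) v.proj →ₗ[ℝ] TangentSpace 𝓘(ℝ, E).tangent v}
    {U : ι → Set M} (hΓ : ∀ i, IsHorizontalLiftOn S (Γ i) (U i))
    (ρ : SmoothPartitionOfUnity ι 𝓘(ℝ, E) M univ) (hρ : ρ.IsSubordinate U) :
    IsHorizontalLiftOn S (fun v => ∑ᶠ i, ρ i v.proj • Γ i v) univ := by
  have hsupp : ∀ v : TangentBundle 𝓘(ℝ, E) M,
      Function.HasFiniteSupport fun i => ρ i v.proj • Γ i v := fun v =>
    (ρ.locallyFinite.point_finite v.proj).subset fun i hi => left_ne_zero_of_smul hi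
  have happly : ∀ (v : TangentBundle 𝓘(ℝ, E) M) (u : TangentSpace 𝓘(ℝ, E) v.proj),
      (∑ᶠ i, ρ i v.proj • Γ i v) u = ∑ᶠ i, ρ i v.proj • Γ i v u := fun v u =>
    map_finsum (LinearMap.applyₗ u : (TangentSpace 𝓘(ℝ, E) v.proj →ₗ[ℝ]
      TangentSpace 𝓘(ℝ, E).tangent v) →ₗ[ℝ] _) (hsupp v)
  have hmem : ∀ (x : M) i, ρ i x ≠ 0 → x ∈ U i := fun x i h => hρ i (subset_closure h)
  have hone : ∀ x : M, ∑ᶠ i, ρ i x = 1 := fun x => ρ.sum_eq_one (mem_univ x)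
  refine ⟨fun v _ u => ?_, fun v _ => ?_, fun X v _ hX => ?_⟩
  · rw [happly, map_finsum]
    · have : ∀ i, projDiff v (ρ i v.proj • Γ i v u) = ρ i v.proj • u := by
        intro i
        by_cases h : ρ i v.proj = 0
        · simp [h]
        · rw [map_smul, (hΓ i).projDiff_apply v (hmem _ _ h)]
      simp_rw [this]
      rw [← finsum_smul, hone, one_smul]
    · exact (ρ.locallyFinite.point_finite v.proj).subset fun i hi => left_ne_zero_of_smul hi
  · rw [happly]
    have : ∀ i, ρ i v.proj • Γ i v v.snd = ρ i v.proj • S v := by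
      intro i
      by_cases h : ρ i v.proj = 0
      · simp [h]
      · rw [(hΓ i).apply_snd v (hmem _ _ h)]
    simp_rw [this]
    rw [← finsum_smul, hone, one_smul]
  · simp_rw [happly]
    have hproj : ContMDiff 𝓘(ℝ, E).tangent 𝓘(ℝ, E) ∞
        (fun w : TangentBundle 𝓘(ℝ, E) M => w.proj) :=
      contMDiff_proj (TangentSpace 𝓘(ℝ, E) (M := M))
    refine ContMDiffAt.finsum_section_of_locallyFinite
      (t := fun i (w : TangentBundle 𝓘(ℝ, E) M) => ρ i w.proj • Γ i w (X w.proj)) ?_ fun i => ?_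
    · exact (ρ.locallyFinite.preimage_continuous hproj.continuous).subset
        fun i w hw => left_ne_zero_of_smul hw
    · by_cases h : v.proj ∈ tsupport (ρ i)
      · exact ContMDiffAt.smul_section (((ρ i).contMDiff.comp hproj) v)
          ((hΓ i).contMDiffAt X v (hρ i h) hX)
      -- Nothing is known about `Γ i` off `U i`, but the weighted term vanishes near `v`.
      · have hzero : ContMDiffAt 𝓘(ℝ, E).tangent 𝓘(ℝ, E).tangent.tangent ∞
            (fun w : TangentBundle 𝓘(ℝ, E) M => (⟨w, 0⟩ :
              TangentBundle 𝓘(ℝ, E).tangent (TangentBundle 𝓘(ℝ, E) M))) v :=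
          (contMDiff_zeroSection ℝ (TangentSpace 𝓘(ℝ, E).tangent)).contMDiffAt
        refine hzero.congr_of_eventuallyEq ?_
        have hopen : (fun w : TangentBundle 𝓘(ℝ, E) M => w.proj) ⁻¹' (tsupport (ρ i))ᶜ ∈ 𝓝 v :=
          hproj.continuous.continuousAt.preimage_mem_nhds
            ((isClosed_tsupport _).isOpen_compl.mem_nhds h)
        filter_upwards [hopen] with w hw
        rw [image_eq_zero_of_notMem_tsupport hw, zero_smul]

/-- The connection whose horizontal spaces are the images of a global horizontal lift. -/
theorem IsHorizontalLiftOn.exists_isCompatible [FiniteDimensional ℝ E]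
    {S : ∀ v : TangentBundle 𝓘(ℝ, E) M, TangentSpace 𝓘(ℝ, E).tangent v}
    {Γ : ∀ v : TangentBundle 𝓘(ℝ, E) M,
      TangentSpace 𝓘(ℝ, E) v.proj →ₗ[ℝ] TangentSpace 𝓘(ℝ, E).tangent v}
    (hΓ : IsHorizontalLiftOn S Γ univ) :
    ∃ H : EhresmannConnection E M, H.IsCompatible S := by
  have hπ : ∀ v u, projDiff v (Γ v u) = u := fun v => hΓ.projDiff_apply v (mem_univ _)
  have hinj : ∀ v, Function.Injective (Γ v) := fun v => Function.LeftInverse.injective (hπ v)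
  let H : EhresmannConnection E M :=
    { hor := fun v => LinearMap.range (Γ v)
      isCompl := fun v => by
        refine ⟨Submodule.disjoint_def.2 ?_, codisjoint_iff.2 (eq_top_iff.2 fun z _ => ?_)⟩
        · rintro _ ⟨u, rfl⟩ hu
          have : projDiff v (Γ v u) = 0 := hu
          rw [hπ] at this
          rw [this, map_zero]
        · refine Submodule.mem_sup.2 ⟨Γ v (projDiff v z), ⟨_, rfl⟩, z - Γ v (projDiff v z), ?_,
            add_sub_cancel _ _⟩
          change projDiff v (z - Γ v (projDiff v z)) = 0
          rw [map_sub, hπ, sub_self]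
      smooth := fun v₀ => by
        -- The lift of a local frame of `TM` is a local frame of the horizontal bundle, by
        -- injectivity of `Γ v`.
        let e := trivializationAt E (TangentSpace 𝓘(ℝ, E)) v₀.proj
        let b := Module.finBasis ℝ E
        have hb := e.isLocalFrameOn_localFrame_baseSet 𝓘(ℝ, E) ∞ b
        have hU : IsOpen ((fun w : TangentBundle 𝓘(ℝ, E) M => w.proj) ⁻¹' e.baseSet) :=
          e.open_baseSet.preimage (FiberBundle.continuous_proj E (TangentSpace 𝓘(ℝ, E) (M := M)))
        refine ⟨_, _, hU.mem_nhds (mem_chart_source E v₀.proj),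
          fun i v => Γ v (e.localFrame b i v.proj), fun i v hv => ?_, fun v hv => ⟨?_, ?_⟩⟩
        · exact (hΓ.contMDiffAt _ v (mem_univ _)
            (hb.contMDiffAt e.open_baseSet hv i)).contMDiffWithinAt
        · exact (hb.linearIndependent hv).map' (Γ v) (LinearMap.ker_eq_bot.2 (hinj v))
        · rw [show (fun i => Γ v (e.localFrame b i v.proj)) =
            Γ v ∘ fun i => e.localFrame b i v.proj from rfl, range_comp, Submodule.span_image,
            top_le_iff.1 (hb.generating hv), Submodule.map_top] }
  refine ⟨H, fun v => ?_⟩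
  have hmem : S v ∈ H.hor v := ⟨v.snd, hΓ.apply_snd v (mem_univ _)⟩
  have h : (H.projEquiv v).symm v.snd = ⟨S v, hmem⟩ := by
    rw [LinearEquiv.symm_apply_eq]
    change v.snd = projDiff v (S v)
    rw [← hΓ.apply_snd v (mem_univ _), hπ]
  exact congrArg Subtype.val h

end HorizontalLift

theorem mainTheorem1 {E : Type*} [NormedAddCommGroup E] [NormedSpace ℝ E] [FiniteDimensional ℝ E]
    {M : Type*} [TopologicalSpace M] [ChartedSpace E M] [IsManifold 𝓘(ℝ, E) ∞ M]
    [T2Space M] [ParacompactSpace M] [ConnectedSpace M]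
    (S : ∀ v : TangentBundle 𝓘(ℝ, E) M, TangentSpace 𝓘(ℝ, E).tangent v)
    (hS : IsQuasispray S) :
    ∃ H : EhresmannConnection E M, H.IsCompatible S := by
  have : CompleteSpace E := FiniteDimensional.complete ℝ E
  have : ProperSpace E := FiniteDimensional.proper ℝ E
  have : LocallyCompactSpace M := ChartedSpace.locallyCompactSpace E M
  -- Needed for the partition of unity; connectedness enters only here.
  have : SigmaCompactSpace M := sigmaCompactSpace_of_connectedSpace M
  choose Γ hΓ using hS.exists_isHorizontalLiftOn
  obtain ⟨ρ, hρ⟩ := SmoothPartitionOfUnity.exists_isSubordinate_chartAt_source 𝓘(ℝ, E) M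
  exact (IsHorizontalLiftOn.finsum hΓ ρ hρ).exists_isCompatible
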